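/- Let $K$ be a field, $\Gamma$ a linearly ordered abelian group, and $\nu: K[x]\to\Gamma\cup\{\infty\}$ a valuation with trivial support, i.e. $\nu(fg)=\nu(f)+\nu(g)$, $\nu(f+g)\ge\min\{\nu(f),\nu(g)\}$, $\nu(1)=0$, and $\nu(f)=\infty$ if and only if $f=0$. Extend $\nu$ to $K(x)$ by $\nu(f/g)=\nu(f)-\nu(g)$, let $\nu K\subseteq \nu(K(x))$ be the value groups and $K\nu\subseteq K(x)\nu$ the residue fields of $\nu|_K$ and of $\nu$ on $K(x)$. The valuation $\nu$ is called valuation-algebraic if $\nu(K(x))/\nu K$ is a torsion group and $K(x)\nu\mid K\nu$ is an algebraic extension, and valuation-transcendental otherwise. (So $\nu$ is valuation-transcendental precisely when it is value-transcendental, i.e. there is a nonzero $f\in K(x)$ with $n\,\nu(f)\notin\nu K$ for all $n\ge 1$, or residue-transcendental, i.e. there is $f\in K(x)$ with $\nu(f)\ge 0$ whose residue is transcendental over $K\nu$.) For a nonconstant polynomial $q\in K[x]$, every $p\in K[x]$ has a unique $q$-expansion $p=p_0+p_1q+\dots+p_nq^n$ with each $p_i\in K[x]$ zero or of degree less than $\deg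 q$; put $\nu_q(p)=\min_{0\le i\le n}\nu(p_iq^i)$. **Theorem.** The valuation $\nu$ is valuation-transcendental if and only if there exists a nonconstant polynomial $q\in K[x]$ such that $\nu=\nu_q$. -/

import Mathlib

open Polynomial

namespace ValTrunc

universe u v

section Expansion

variable {K : Type u} [Field K]

/-- The `i`-th coefficient `p_i` of the `q`-expansion `p = p_0 + p_1 q + ... + p_n q ^ n`, obtained
by repeated division with remainder by `q` (meaningful for nonconstant `q`, see
`sum_expansionCoeff`, `degree_expansionCoeff_lt` and `expansionCoeff_unique` below). -/
noncomputable def expansionCoeff (q : K[X]) : K[X] → ℕ → K[X]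
  | p, 0 => p % q
  | p, i + 1 => expansionCoeff q (p / q) i

theorem expansionCoeff_zero_left (q : K[X]) (i : ℕ) : expansionCoeff q 0 i = 0 := by
  induction i with
  | zero => simp [expansionCoeff]
  | succ i ih => simp [expansionCoeff, ih]

/-- Each coefficient of the `q`-expansion is zero or of degree smaller than `deg q`. -/
theorem degree_expansionCoeff_lt {q : K[X]} (hq : 0 < q.natDegree) (p : K[X]) (i : ℕ) :
    (expansionCoeff q p i).degree < q.degree := by
  have hq0 : q ≠ 0 := by rintro rfl; simp at hq
  induction i generalizing p with
  | zero => exact EuclideanDomain.mod_lt p hq0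
  | succ i ih => exact ih (p / q)

/-- The `q`-expansion of `p` sums up to `p`; it stops after at most `deg p + 1` terms. -/
theorem sum_expansionCoeff {q : K[X]} (hq : 0 < q.natDegree) (p : K[X]) (n : ℕ)
    (hn : p.natDegree < n) :
    ∑ i ∈ Finset.range n, expansionCoeff q p i * q ^ i = p := by
  induction n generalizing p with
  | zero => omega
  | succ n ih =>
    rw [Finset.sum_range_succ']
    have h1 : ∑ i ∈ Finset.range n, expansionCoeff q p (i + 1) * q ^ (i + 1)
        = (p / q) * q := by
      by_cases h0 : p / q = 0
      · simp [expansionCoeff, h0, expansionCoeff_zero_left]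
      · have hd : (p / q).natDegree < n := by
          have hp : p ≠ 0 := by rintro rfl; simp at h0
          have := Polynomial.natDegree_lt_natDegree h0
            (Polynomial.degree_div_lt hp (Polynomial.natDegree_pos_iff_degree_pos.1 hq))
          omega
        conv_rhs => rw [← ih (p / q) hd, Finset.sum_mul]
        refine Finset.sum_congr rfl fun i _ => ?_
        rw [expansionCoeff]; ring
    rw [h1]
    simp only [expansionCoeff, pow_zero, mul_one]
    rw [mul_comm]; exact EuclideanDomain.div_add_mod p q

/-- Uniqueness of the `q`-expansion. -/
theorem expansionCoeff_unique {q : K[X]} (hq : 0 < q.natDegree) (n : ℕ) (c : ℕ → K[X])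
    (hc : ∀ i, (c i).degree < q.degree) (p : K[X])
    (hp : ∑ i ∈ Finset.range n, c i * q ^ i = p) (i : ℕ) (hi : i < n) :
    expansionCoeff q p i = c i := by
  have hq0 : q ≠ 0 := by rintro rfl; simp at hq
  induction n generalizing c p i with
  | zero => omega
  | succ n ih =>
    rw [Finset.sum_range_succ'] at hp
    have h1 : p = q * (∑ j ∈ Finset.range n, c (j + 1) * q ^ j) + c 0 := by
      rw [← hp, Finset.mul_sum]
      simp only [pow_zero, mul_one, add_left_inj]
      exact Finset.sum_congr rfl fun j _ => by ring
    have h3 : c 0 % q = c 0 := (Polynomial.mod_eq_self_iff hq0).2 (hc 0)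
    have h4 : p % q = c 0 := by
      rw [h1, Polynomial.add_mod, h3]
      simp
    have h5 : p / q = ∑ j ∈ Finset.range n, c (j + 1) * q ^ j := by
      have h := EuclideanDomain.div_add_mod p q
      rw [h4] at h
      nth_rewrite 2 [h1] at h
      exact mul_left_cancel₀ hq0 (add_right_cancel h)
    cases i with
    | zero =>
      rw [expansionCoeff, h4]
    | succ i =>
      rw [expansionCoeff]
      exact ih (fun j => c (j + 1)) (fun j => hc _) (p / q) h5.symm i (by omega)

end Expansion

section Valuations

variable {K : Type u} [Field K] {Γ : Type v} [AddCommGroup Γ] [LinearOrder Γ]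
  [IsOrderedAddMonoid Γ]

/-- The `q`-truncation `ν_q(p) = min_i ν(p_i q ^ i)` of `ν`, where `p = ∑ p_i q ^ i` is the
`q`-expansion of `p`. All coefficients with index larger than `deg p` vanish when `q` is not
constant, and vanishing coefficients contribute the value `∞`. -/
noncomputable def truncation (ν : AddValuation K[X] (WithTop Γ)) (q p : K[X]) : WithTop Γ :=
  (Finset.range (p.natDegree + 1)).inf fun i => ν (expansionCoeff q p i * q ^ i)

/-- The truncation may be computed from any expression of `p` as a `q`-expansion. -/
theorem truncation_eq (ν : AddValuation K[X] (WithTop Γ)) {q : K[X]} (hq : 0 < q.natDegree)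
    (n : ℕ) (c : ℕ → K[X]) (hc : ∀ i, (c i).degree < q.degree) (p : K[X])
    (hp : ∑ i ∈ Finset.range n, c i * q ^ i = p) :
    truncation ν q p = (Finset.range n).inf fun i => ν (c i * q ^ i) := by
  have key : ∀ m, p.natDegree < m → n ≤ m →
      (Finset.range m).inf (fun i => ν (expansionCoeff q p i * q ^ i)) =
        (Finset.range n).inf fun i => ν (c i * q ^ i) := by
    intro m hm hnm
    have hq0 : ⊥ < q.degree := bot_lt_iff_ne_bot.2 fun h => by
      rw [degree_eq_bot] at h; simp [h] at hq
    set d : ℕ → K[X] := fun i => if i < n then c i else 0 with hd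
    have hdd : ∀ i, (d i).degree < q.degree := by
      intro i
      simp only [hd]
      split_ifs
      · exact hc i
      · simpa using hq0
    have hsub : Finset.range n ⊆ Finset.range m := Finset.range_subset_range.2 hnm
    have hds : ∑ i ∈ Finset.range m, d i * q ^ i = p := by
      rw [← hp, ← Finset.sum_subset hsub]
      · refine Finset.sum_congr rfl fun i hi => ?_
        simp [hd, Finset.mem_range.1 hi]
      · intro i _ hi
        have : ¬ i < n := fun h => hi (Finset.mem_range.2 h)
        simp [hd, this]
    have he := expansionCoeff_unique hq m d hdd p hds
    apply le_antisymm
    · refine Finset.le_inf fun i hi => ?_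
      refine (Finset.inf_le (hsub hi)).trans ?_
      have hi' := Finset.mem_range.1 hi
      rw [he i (by omega)]
      simp [hd, hi']
    · refine Finset.le_inf fun i hi => ?_
      rw [he i (Finset.mem_range.1 hi)]
      by_cases h : i < n
      · simpa [hd, h] using Finset.inf_le (f := fun i => ν (c i * q ^ i)) (Finset.mem_range.2 h)
      · simp [hd, h]
  by_cases hle : n ≤ p.natDegree + 1
  · exact key _ (by omega) hle
  · rw [← key n (by omega) le_rfl, truncation]
    have h0 := key n (by omega) le_rfl
    have hs := sum_expansionCoeff hq p (p.natDegree + 1) (by omega)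
    have hz : ∀ i, i < n → ¬ i < p.natDegree + 1 → expansionCoeff q p i = 0 := by
      intro i hi hi2
      have hq0 : ⊥ < q.degree := bot_lt_iff_ne_bot.2 fun h => by
        rw [degree_eq_bot] at h; simp [h] at hq
      have hu := expansionCoeff_unique hq n
        (fun j => if j < p.natDegree + 1 then expansionCoeff q p j else 0) (fun j => by
          split_ifs
          · exact degree_expansionCoeff_lt hq p j
          · simpa using hq0) p (by
          conv_rhs => rw [← hs]
          rw [← Finset.sum_subset (Finset.range_subset_range.2 (by omega :
            p.natDegree + 1 ≤ n))]
          · refine Finset.sum_congr rfl fun i hi => ?_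
            rw [if_pos (Finset.mem_range.1 hi)]
          · intro i _ hi
            rw [if_neg (fun h => hi (Finset.mem_range.2 h)), zero_mul]) i hi
      rw [hu, if_neg hi2]
    apply le_antisymm
    · refine Finset.le_inf fun i hi => ?_
      by_cases h : i < p.natDegree + 1
      · exact Finset.inf_le (f := fun i => ν (expansionCoeff q p i * q ^ i)) (Finset.mem_range.2 h)
      · rw [hz i (Finset.mem_range.1 hi) h]; simp
    · exact Finset.inf_mono (Finset.range_subset_range.2 (by omega))

/-- The restriction of `ν` to the constants `K`. -/
noncomputable def baseVal (ν : AddValuation K[X] (WithTop Γ)) : AddValuation K (WithTop Γ) :=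
  ν.comap C

theorem nonZeroDivisors_le_primeCompl (ν : AddValuation K[X] (WithTop Γ)) (hν : ν.supp = ⊥) :
    nonZeroDivisors K[X] ≤ (AddValuation.toValuation ν).supp.primeCompl := by
  intro p hp hmem
  have h : p ∈ ν.supp := hmem
  rw [hν, Ideal.mem_bot] at h
  exact nonZeroDivisors.ne_zero hp h

/-- The extension of a valuation `ν` on `K[x]` with zero support to `K(x)`, that is
`ν(f / g) = ν(f) - ν(g)`. -/
noncomputable def ratVal (ν : AddValuation K[X] (WithTop Γ)) (hν : ν.supp = ⊥) :
    AddValuation (RatFunc K) (WithTop Γ) :=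
  AddValuation.ofValuation ((AddValuation.toValuation ν).extendToLocalization
    (nonZeroDivisors_le_primeCompl ν hν) (RatFunc K))

theorem ratVal_algebraMap (ν : AddValuation K[X] (WithTop Γ)) (hν : ν.supp = ⊥) (p : K[X]) :
    ratVal ν hν (algebraMap K[X] (RatFunc K) p) = ν p :=
  Valuation.extendToLocalization_apply_map_apply (AddValuation.toValuation ν)
    (nonZeroDivisors_le_primeCompl ν hν) (RatFunc K) p

theorem ratVal_div (ν : AddValuation K[X] (WithTop Γ)) (hν : ν.supp = ⊥) (f g : K[X]) :
    ratVal ν hν (algebraMap K[X] (RatFunc K) f / algebraMap K[X] (RatFunc K) g) = ν f - ν g := by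
  rw [AddValuation.map_div, ratVal_algebraMap, ratVal_algebraMap]

/-- The value group of a valuation: the subgroup of `Γ` generated by the finite values. -/
def valueGroup {R : Type u} [CommRing R] (w : AddValuation R (WithTop Γ)) : AddSubgroup Γ :=
  AddSubgroup.closure {γ : Γ | ∃ a : R, w a = (γ : WithTop Γ)}

/-- The valuation ring `{a | w a ≥ 0}` of a valuation on a field. -/
abbrev valRing {F : Type u} [Field F] (w : AddValuation F (WithTop Γ)) : ValuationSubring F :=
  (AddValuation.toValuation w).valuationSubring

theorem mem_valRing {F : Type u} [Field F] (w : AddValuation F (WithTop Γ)) (a : F) :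
    a ∈ valRing w ↔ 0 ≤ w a := Iff.rfl

/-- The residue field of a valuation on a field. -/
abbrev ResField {F : Type u} [Field F] (w : AddValuation F (WithTop Γ)) : Type u :=
  IsLocalRing.ResidueField (valRing w)

theorem ratVal_algebraMap_base (ν : AddValuation K[X] (WithTop Γ)) (hν : ν.supp = ⊥) (a : K) :
    ratVal ν hν (algebraMap K (RatFunc K) a) = baseVal ν a := by
  rw [IsScalarTower.algebraMap_apply K K[X] (RatFunc K), ratVal_algebraMap]
  rfl

/-- `ratVal ν` extends `baseVal ν`; this provides the inclusion `Kν → K(x)ν` of residue fields,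
sending the residue of `a` to the residue of the constant `a`. -/
instance hasExtension_ratVal (ν : AddValuation K[X] (WithTop Γ)) (hν : ν.supp = ⊥) :
    Valuation.HasExtension (AddValuation.toValuation (baseVal ν))
      (AddValuation.toValuation (ratVal ν hν)) where
  val_isEquiv_comap := by
    have h : AddValuation.toValuation (baseVal ν)
        = (AddValuation.toValuation (ratVal ν hν)).comap (algebraMap K (RatFunc K)) := by
      ext a
      exact (congrArg (fun t => Multiplicative.ofAdd (OrderDual.toDual t))
        (ratVal_algebraMap_base ν hν a)).symm
    rw [h]
    exact Valuation.IsEquiv.refl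

/-- The inclusion `Kν → K(x)ν` sends the residue of `a` to the residue of the constant `a`. -/
theorem algebraMap_residue (ν : AddValuation K[X] (WithTop Γ)) (hν : ν.supp = ⊥)
    (a : valRing (baseVal ν)) (ha : algebraMap K (RatFunc K) a ∈ valRing (ratVal ν hν)) :
    algebraMap (ResField (baseVal ν)) (ResField (ratVal ν hν))
        (IsLocalRing.residue (valRing (baseVal ν)) a) =
      IsLocalRing.residue (valRing (ratVal ν hν)) ⟨algebraMap K (RatFunc K) a, ha⟩ :=
  rfl

/-- `ν` is valuation-algebraic if `ν(K(x)) / νK` is a torsion group and `K(x)ν | Kν` is an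
algebraic extension. -/
def IsValuationAlgebraic (ν : AddValuation K[X] (WithTop Γ)) (hν : ν.supp = ⊥) : Prop :=
  IsAddTorsion (valueGroup (ratVal ν hν) ⧸
      (valueGroup (baseVal ν)).addSubgroupOf (valueGroup (ratVal ν hν))) ∧
    Algebra.IsAlgebraic (ResField (baseVal ν)) (ResField (ratVal ν hν))

/-- `ν` is valuation-transcendental if it is not valuation-algebraic. -/
def IsValuationTranscendental (ν : AddValuation K[X] (WithTop Γ)) (hν : ν.supp = ⊥) : Prop :=
  ¬ IsValuationAlgebraic ν hν

/-- `ν` is value-transcendental if some `f ∈ K(x)` has a value in `Γ` no positive multiple of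
which lies in `νK`. -/
def IsValueTranscendental (ν : AddValuation K[X] (WithTop Γ)) (hν : ν.supp = ⊥) : Prop :=
  ∃ (f : RatFunc K) (γ : Γ), ratVal ν hν f = (γ : WithTop Γ) ∧
    ∀ n : ℕ, 0 < n → n • γ ∉ valueGroup (baseVal ν)

/-- `ν` is residue-transcendental if some `f` in the valuation ring of `K(x)` has a residue that
is transcendental over `Kν`. -/
def IsResidueTranscendental (ν : AddValuation K[X] (WithTop Γ)) (hν : ν.supp = ⊥) : Prop :=
  ∃ f : valRing (ratVal ν hν),
    Transcendental (ResField (baseVal ν)) (IsLocalRing.residue (valRing (ratVal ν hν)) f)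

/-- Over a field the value group is just the set of finite values. -/
theorem mem_valueGroup_iff {F : Type u} [Field F] (w : AddValuation F (WithTop Γ)) (γ : Γ) :
    γ ∈ valueGroup w ↔ ∃ a : F, w a = (γ : WithTop Γ) := by
  refine ⟨fun h => ?_, fun h => AddSubgroup.subset_closure h⟩
  induction h using AddSubgroup.closure_induction with
  | mem x hx => exact hx
  | zero => exact ⟨1, w.map_one⟩
  | add x y _ _ hx hy =>
    obtain ⟨a, ha⟩ := hx
    obtain ⟨b, hb⟩ := hy
    exact ⟨a * b, by rw [w.map_mul, ha, hb, WithTop.coe_add]⟩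
  | neg x _ hx =>
    obtain ⟨a, ha⟩ := hx
    exact ⟨a⁻¹, by rw [w.map_inv, ha]; rfl⟩

/-- A valuation is valuation-transcendental if and only if it is value-transcendental or
residue-transcendental. -/
theorem isValuationTranscendental_iff (ν : AddValuation K[X] (WithTop Γ)) (hν : ν.supp = ⊥) :
    IsValuationTranscendental ν hν ↔
      IsValueTranscendental ν hν ∨ IsResidueTranscendental ν hν := by
  have h1 : IsValueTranscendental ν hν ↔ ¬ IsAddTorsion (valueGroup (ratVal ν hν) ⧸
      (valueGroup (baseVal ν)).addSubgroupOf (valueGroup (ratVal ν hν))) := by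
    rw [not_isAddTorsion_iff]
    constructor
    · rintro ⟨f, γ, hf, hγ⟩
      refine ⟨QuotientAddGroup.mk ⟨γ, (mem_valueGroup_iff _ _).2 ⟨f, hf⟩⟩, fun hfin => ?_⟩
      obtain ⟨n, hn, h⟩ := isOfFinAddOrder_iff_nsmul_eq_zero.1 hfin
      rw [← QuotientAddGroup.mk_nsmul, QuotientAddGroup.eq_zero_iff] at h
      exact hγ n hn h
    · rintro ⟨x, hx⟩
      induction x using QuotientAddGroup.induction_on with
      | H z =>
        obtain ⟨γ, hz⟩ := z
        obtain ⟨f, hf⟩ := (mem_valueGroup_iff _ _).1 hz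
        refine ⟨f, γ, hf, fun n hn hmem => hx (isOfFinAddOrder_iff_nsmul_eq_zero.2 ⟨n, hn, ?_⟩)⟩
        rw [← QuotientAddGroup.mk_nsmul, QuotientAddGroup.eq_zero_iff]
        exact hmem
  have h2 : IsResidueTranscendental ν hν ↔
      ¬ Algebra.IsAlgebraic (ResField (baseVal ν)) (ResField (ratVal ν hν)) := by
    rw [Algebra.isAlgebraic_def]
    push Not
    constructor
    · rintro ⟨f, hf⟩
      exact ⟨_, hf⟩
    · rintro ⟨y, hy⟩
      obtain ⟨f, rfl⟩ := IsLocalRing.residue_surjective y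
      exact ⟨f, hy⟩
  rw [h1, h2, IsValuationTranscendental, IsValuationAlgebraic, not_and_or]

end Valuations

end ValTrunc

/-!
Suppose `ν` is valuation-transcendental. Then the valuation ring of `ν` on `K(x)` contains a
valuation ring `V` (itself in the value-transcendental case, a composite with a valuation ring of
the residue field in the residue-transcendental case) for which some `f ∈ K(x)` has a value
that is non-torsion modulo the values of `K`. Let `q` be a polynomial of least degree with such a
value. The coefficients of every `q`-expansion have torsion values, so the nonzero terms
`p_i q ^ i` have pairwise distinct `V`-values and hence, writing `V` multiplicatively, none of them
exceeds the `V`-value of their sum `p`. Since `V` is finer than `ν`, it follows that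
`ν p ≤ ν (p_i q ^ i)` for all `i`, that is `ν = ν_q`.

Conversely, let `ν = ν_q`. If `ν q` is torsion modulo `νK`, then some `g = a q ^ n` has value `0`,
and `ν = ν_q` bounds the value of `∑ c_i g ^ i` by each `ν c_i`, so `g` has transcendental residue.
-/

namespace ValTrunc

open IsLocalRing

section DistinctValues

variable {R Γ₀ ι : Type*} [Ring R] [LinearOrderedCommGroupWithZero Γ₀]

theorem map_le_map_sum_of_distinct (v : Valuation R Γ₀) {s : Finset ι} {f : ι → R}
    (hf : ∀ i ∈ s, ∀ j ∈ s, v (f i) = v (f j) → v (f i) ≠ 0 → i = j) {i : ι} (hi : i ∈ s) :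
    v (f i) ≤ v (∑ j ∈ s, f j) := by
  classical
  obtain ⟨j, hj, hmax⟩ := s.exists_max_image (fun i => v (f i)) ⟨i, hi⟩
  rcases eq_or_ne (v (f j)) 0 with hzero | hzero
  · exact (hmax i hi).trans (hzero.trans_le zero_le)
  · rw [v.map_sum_eq_of_lt hj]
    · exact hmax i hi
    · intro k hk
      rw [Finset.mem_sdiff, Finset.mem_singleton] at hk
      exact (hmax k hk.1).lt_of_ne fun h => hk.2 (hf j hj k hk.1 h.symm hzero).symm

end DistinctValues

section TorsionValues

/-- The value of `x` is torsion modulo the values of `K`: some positive power of `x` has the same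
value as a constant. In particular this holds for `x = 0`. -/
def HasTorsionValue (K : Type*) {F Γ₀ : Type*} [Field K] [Field F] [Algebra K F]
    [LinearOrderedCommGroupWithZero Γ₀] (v : Valuation F Γ₀) (x : F) : Prop :=
  ∃ n : ℕ, 0 < n ∧ ∃ a : K, v x ^ n = v (algebraMap K F a)

variable {K F Γ₀ : Type*} [Field K] [Field F] [Algebra K F] [LinearOrderedCommGroupWithZero Γ₀]
  {v : Valuation F Γ₀} {x y : F}

theorem hasTorsionValue_algebraMap (v : Valuation F Γ₀) (a : K) :
    HasTorsionValue K v (algebraMap K F a) :=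
  ⟨1, one_pos, a, pow_one _⟩

theorem HasTorsionValue.div (hx : HasTorsionValue K v x) (hy : HasTorsionValue K v y) :
    HasTorsionValue K v (x / y) := by
  obtain ⟨n, hn, a, ha⟩ := hx
  obtain ⟨m, hm, b, hb⟩ := hy
  refine ⟨n * m, Nat.mul_pos hn hm, a ^ m / b ^ n, ?_⟩
  rw [map_div₀, div_pow, pow_mul, ha, mul_comm n m, pow_mul, hb, map_div₀, map_div₀, map_pow,
    map_pow, map_pow, map_pow]

theorem HasTorsionValue.of_pow_eq {n : ℕ} (hn : 0 < n) (hx : HasTorsionValue K v x)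
    (h : v y ^ n = v x) : HasTorsionValue K v y := by
  obtain ⟨m, hm, a, ha⟩ := hx
  exact ⟨n * m, Nat.mul_pos hn hm, a, by rw [pow_mul, h, ha]⟩

theorem exponent_eq_of_map_mul_pow_eq {a b : F} (ha : HasTorsionValue K v a)
    (hb : HasTorsionValue K v b) (hy : ¬ HasTorsionValue K v y) {i j : ℕ}
    (h : v (a * y ^ i) = v (b * y ^ j)) (h_ne : v (a * y ^ i) ≠ 0) : i = j := by
  wlog hij : i ≤ j generalizing a b i j
  · exact (this hb ha h.symm (h ▸ h_ne) (le_of_not_ge hij)).symm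
  obtain ⟨d, rfl⟩ := Nat.exists_eq_add_of_le hij
  by_contra hd
  rw [h] at h_ne
  simp only [map_mul, map_pow] at h h_ne
  obtain ⟨hb_ne, hpow_ne⟩ := mul_ne_zero_iff.1 h_ne
  have hy_ne : v y ^ i ≠ 0 := fun h0 => hpow_ne (by rw [pow_add, h0, zero_mul])
  refine hy ((ha.div hb).of_pow_eq (n := d) (by omega) ?_)
  rw [map_div₀, eq_div_iff hb_ne]
  refine mul_right_cancel₀ hy_ne ?_
  rw [h, pow_add]
  ac_rfl

end TorsionValues

section FinerValuationRing

variable {Γ F : Type*} [AddCommGroup Γ] [LinearOrder Γ] [IsOrderedAddMonoid Γ] [Field F]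
  {w : AddValuation F (WithTop Γ)}

theorem mem_maximalIdeal_valRing_iff {x : valRing w} :
    x ∈ maximalIdeal (valRing w) ↔ 0 < w x :=
  (AddValuation.toValuation w).mem_maximalIdeal_iff

theorem le_of_valuation_le {V : ValuationSubring F} (hV : V ≤ valRing w) {x y : F}
    (h : V.valuation x ≤ V.valuation y) : w y ≤ w x := by
  obtain ⟨a, rfl⟩ := (V.valuation_le_iff x y).1 h
  rw [AddValuation.map_mul]
  exact le_add_of_nonneg_left ((mem_valRing w _).1 (hV a.2))

theorem eq_of_valuation_eq {V : ValuationSubring F} (hV : V ≤ valRing w) {x y : F}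
    (h : V.valuation x = V.valuation y) : w x = w y :=
  le_antisymm (le_of_valuation_le hV h.ge) (le_of_valuation_le hV h.le)

end FinerValuationRing

section TranscendentalResidue

theorem not_isUnit_adjoin_self {k L : Type*} [CommRing k] [Nontrivial k] [CommRing L] [Algebra k L]
    {t : L} (ht : Transcendental k t) :
    ¬ IsUnit (⟨t, Algebra.self_mem_adjoin_singleton k t⟩ : Algebra.adjoin k {t}) := by
  have h_apply : Polynomial.algEquivOfTranscendental k t ht X =
      ⟨t, Algebra.self_mem_adjoin_singleton k t⟩ := by simp
  rw [← h_apply, MulEquiv.isUnit_map]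
  exact not_isUnit_X

/-- `V` is the composite of `A` with a valuation ring of its residue field that contains `k` and
has the residue of `f` in its maximal ideal. -/
theorem exists_valuationSubring_le_of_transcendental_residue {k F : Type*} [CommRing k]
    [Nontrivial k] [Field F] (A : ValuationSubring F) [Algebra k (ResidueField A)] {f : A}
    (hf : Transcendental k (residue A f)) :
    ∃ V ≤ A, V.valuation f < 1 ∧
      ∀ (c : k) (x : A), residue A x = algebraMap k _ c → (x : F) ∈ V := by
  set t := residue A f
  set R : Subring F := ((Algebra.adjoin k {t}).toSubring.comap (residue A)).map A.subtype
  have hRA : R ≤ A.toSubring := by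
    rintro _ ⟨x, -, rfl⟩
    exact x.2
  have mem_R : ∀ x : A, residue A x ∈ Algebra.adjoin k {t} → (x : F) ∈ R := fun x hx => ⟨x, hx, rfl⟩
  let φ : R →+* Algebra.adjoin k {t} :=
    ((residue A).comp (Subring.inclusion hRA)).codRestrict (Algebra.adjoin k {t}) (by
      rintro ⟨_, x, hx, rfl⟩
      exact hx)
  let I : Ideal R := (Ideal.span {⟨t, Algebra.self_mem_adjoin_singleton k t⟩}).comap φ
  have hI : I ≠ ⊤ := Ideal.comap_ne_top φ fun h_top =>
    not_isUnit_adjoin_self hf (Ideal.span_singleton_eq_top.1 h_top)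
  obtain ⟨V, hRV, hIV⟩ := Ideal.image_subset_nonunits_valuationSubring I hI
  refine ⟨V, ValuationSubring.nonunits_le_nonunits.1 fun x hx => ?_, ?_, fun c x hx => ?_⟩
  · obtain ⟨hxA, hx_max⟩ := A.mem_nonunits_iff_exists_mem_maximalIdeal.1 hx
    have hx_res : residue A ⟨x, hxA⟩ = 0 := (residue_eq_zero_iff _).2 hx_max
    have hxR : x ∈ R := mem_R ⟨x, hxA⟩ (hx_res ▸ zero_mem _)
    have hφx : φ ⟨x, hxR⟩ = 0 := Subtype.ext hx_res
    exact hIV ⟨⟨x, hxR⟩, Ideal.mem_comap.2 (hφx ▸ zero_mem _), rfl⟩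
  · exact hIV ⟨⟨f, mem_R f (Algebra.self_mem_adjoin_singleton k t)⟩,
      Ideal.mem_comap.2 (Ideal.subset_span rfl), rfl⟩
  · exact hRV (mem_R x (hx ▸ Subalgebra.algebraMap_mem _ c))

theorem transcendental_residue_of_coeff_mem {R S : Type*} [CommRing R] [IsLocalRing R] [CommRing S]
    [IsLocalRing S] [Algebra R S] [IsLocalHom (algebraMap R S)] {g : S}
    (h : ∀ P : R[X], aeval g P ∈ maximalIdeal S → ∀ i, P.coeff i ∈ maximalIdeal R) :
    Transcendental (ResidueField R) (residue S g) := by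
  rw [transcendental_iff]
  intro Q hQ
  obtain ⟨P, rfl⟩ := map_surjective _ residue_surjective Q
  have hP : aeval g P ∈ maximalIdeal S := by
    rw [← residue_eq_zero_iff, ← hQ, aeval_def, aeval_def, eval₂_map, hom_eval₂]
    rfl
  ext i
  rw [coeff_map, coeff_zero, residue_eq_zero_iff]
  exact h P hP i

end TranscendentalResidue

section Truncation

universe u v

variable {K : Type u} [Field K] {Γ : Type v} [AddCommGroup Γ] [LinearOrder Γ]
  [IsOrderedAddMonoid Γ] {ν : AddValuation K[X] (WithTop Γ)} {hν : ν.supp = ⊥} {q : K[X]}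

theorem truncation_le (ν : AddValuation K[X] (WithTop Γ)) (hq : 0 < q.natDegree) (p : K[X]) :
    truncation ν q p ≤ ν p := by
  conv_rhs => rw [← sum_expansionCoeff hq p _ (Nat.lt_succ_self _)]
  exact ν.map_le_sum fun i hi => Finset.inf_le hi

theorem le_of_eq_truncation (hq : 0 < q.natDegree) (h : ∀ p, ν p = truncation ν q p) (P : K[X])
    (i : ℕ) : ν (P.comp q) ≤ ν (C (P.coeff i) * q ^ i) := by
  by_cases hi : i < P.natDegree + 1
  · have h_sum : ∑ j ∈ Finset.range (P.natDegree + 1), C (P.coeff j) * q ^ j = P.comp q :=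
      (eval₂_eq_sum_range ..).symm
    rw [h, truncation_eq ν hq _ _
      (fun _ => degree_C_le.trans_lt (natDegree_pos_iff_degree_pos.1 hq)) _ h_sum]
    exact Finset.inf_le (Finset.mem_range.2 hi)
  · rw [coeff_eq_zero_of_natDegree_lt (by omega), C_0, zero_mul, AddValuation.map_zero]
    exact le_top

theorem map_comp_le_of_eq_truncation (hq : 0 < q.natDegree) (h : ∀ p, ν p = truncation ν q p)
    {n : ℕ} (hn : 0 < n) {a : K} (ha : ν (C a * q ^ n) = 0) (P : K[X]) (i : ℕ) :
    ν (P.comp (C a * q ^ n)) ≤ baseVal ν (P.coeff i) := by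
  have h_comp : (expand K n (P.comp (C a * X))).comp q = P.comp (C a * q ^ n) := by
    simp only [expand_eq_comp_X_pow, comp_assoc, mul_comp, C_comp, X_comp, pow_comp]
  have h_coeff : (expand K n (P.comp (C a * X))).coeff (i * n) = P.coeff i * a ^ i := by
    rw [coeff_expand_mul hn, comp_C_mul_X_coeff]
  have h_term : C (P.coeff i * a ^ i) * q ^ (i * n) = C (P.coeff i) * (C a * q ^ n) ^ i := by
    rw [C_mul, C_pow, mul_pow (C a), ← pow_mul, mul_comm n, mul_assoc]
  calc ν (P.comp (C a * q ^ n))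
      ≤ ν (C (P.coeff i * a ^ i) * q ^ (i * n)) := by
        rw [← h_comp, ← h_coeff]
        exact le_of_eq_truncation hq h _ _
    _ = ν (C (P.coeff i)) := by
        rw [h_term, AddValuation.map_mul, AddValuation.map_pow, ha, nsmul_zero, add_zero]

theorem isResidueTranscendental_of_eq_truncation (hq : 0 < q.natDegree)
    (h : ∀ p, ν p = truncation ν q p) {n : ℕ} (hn : 0 < n) {a : K} (ha : ν (C a * q ^ n) = 0) :
    IsResidueTranscendental ν hν := by
  have hg : algebraMap K[X] (RatFunc K) (C a * q ^ n) ∈ valRing (ratVal ν hν) := by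
    rw [mem_valRing, ratVal_algebraMap, ha]
  refine ⟨⟨_, hg⟩, transcendental_residue_of_coeff_mem fun P hP i => ?_⟩
  let P' : K[X] := P.map (algebraMap (valRing (baseVal ν)) K)
  have h_aeval : ((aeval (⟨_, hg⟩ : valRing (ratVal ν hν)) P : valRing (ratVal ν hν)) : RatFunc K) =
      algebraMap K[X] (RatFunc K) (P'.comp (C a * q ^ n)) := by
    rw [comp_eq_aeval, ← aeval_algebraMap_apply, aeval_def, aeval_def, eval₂_map]
    exact hom_eval₂ P _ (valRing (ratVal ν hν)).subtype _
  rw [mem_maximalIdeal_valRing_iff, h_aeval, ratVal_algebraMap] at hP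
  rw [mem_maximalIdeal_valRing_iff]
  simpa [P'] using hP.trans_le (map_comp_le_of_eq_truncation hq h hn ha P' i)

theorem isValuationTranscendental_of_eq_truncation (hq : 0 < q.natDegree)
    (h : ∀ p, ν p = truncation ν q p) : IsValuationTranscendental ν hν := by
  rw [isValuationTranscendental_iff]
  have hνq : ν q ≠ ⊤ := fun h_top => ne_zero_of_natDegree_gt hq (by
    rwa [← AddValuation.mem_supp_iff, hν, Ideal.mem_bot] at h_top)
  obtain ⟨γ, hγ⟩ := WithTop.ne_top_iff_exists.1 hνq
  by_cases h_torsion : ∃ n : ℕ, 0 < n ∧ n • γ ∈ valueGroup (baseVal ν)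
  · obtain ⟨n, hn, hmem⟩ := h_torsion
    obtain ⟨a, ha⟩ := (mem_valueGroup_iff _ _).1 (neg_mem hmem)
    refine Or.inr (isResidueTranscendental_of_eq_truncation hq h hn (a := a) ?_)
    calc ν (C a * q ^ n) = baseVal ν a + n • ν q := by
          rw [AddValuation.map_mul, AddValuation.map_pow]; rfl
      _ = 0 := by
          rw [ha, ← hγ, ← WithTop.coe_nsmul, ← WithTop.coe_add, neg_add_cancel, WithTop.coe_zero]
  · push Not at h_torsion
    exact Or.inl ⟨algebraMap K[X] (RatFunc K) q, γ, by rw [ratVal_algebraMap, hγ], h_torsion⟩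

theorem exists_minimal_not_hasTorsionValue {Γ₀ : Type*} [LinearOrderedCommGroupWithZero Γ₀]
    {v : Valuation (RatFunc K) Γ₀} {f : RatFunc K} (hf : ¬ HasTorsionValue K v f) :
    ∃ q : K[X], MinimalFor (fun p => ¬ HasTorsionValue K v (algebraMap K[X] (RatFunc K) p))
      degree q := by
  refine exists_minimalFor_of_wellFoundedLT _ _ ?_
  by_contra! h
  refine hf ?_
  rw [← RatFunc.num_div_denom f]
  exact (h _).div (h _)

theorem natDegree_pos_of_not_hasTorsionValue {Γ₀ : Type*} [LinearOrderedCommGroupWithZero Γ₀]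
    {v : Valuation (RatFunc K) Γ₀}
    (h : ¬ HasTorsionValue K v (algebraMap K[X] (RatFunc K) q)) : 0 < q.natDegree := by
  rw [Nat.pos_iff_ne_zero]
  intro h_deg
  obtain ⟨a, rfl⟩ := natDegree_eq_zero.1 h_deg
  exact h (hasTorsionValue_algebraMap v a)

theorem map_expansion_term_le {Γ₀ : Type*} [LinearOrderedCommGroupWithZero Γ₀]
    {v : Valuation (RatFunc K) Γ₀}
    (hq : MinimalFor (fun p => ¬ HasTorsionValue K v (algebraMap K[X] (RatFunc K) p)) degree q)
    (p : K[X]) {i : ℕ} (hi : i ∈ Finset.range (p.natDegree + 1)) :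
    v (algebraMap K[X] (RatFunc K) (expansionCoeff q p i * q ^ i)) ≤
      v (algebraMap K[X] (RatFunc K) p) := by
  have hq_pos := natDegree_pos_of_not_hasTorsionValue hq.prop
  have h_coeff : ∀ j, HasTorsionValue K v (algebraMap K[X] (RatFunc K) (expansionCoeff q p j)) :=
    fun j => not_not.1 (hq.not_prop_of_lt (degree_expansionCoeff_lt hq_pos p j))
  conv_rhs => rw [← sum_expansionCoeff hq_pos p _ (Nat.lt_succ_self _), map_sum]
  refine map_le_map_sum_of_distinct v (f := fun j =>
    algebraMap K[X] (RatFunc K) (expansionCoeff q p j * q ^ j)) (fun j _ k _ h h_ne => ?_) hi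
  simp only [map_mul (algebraMap K[X] (RatFunc K)), map_pow (algebraMap K[X] (RatFunc K))]
    at h h_ne
  exact exponent_eq_of_map_mul_pow_eq (h_coeff j) (h_coeff k) hq.prop h h_ne

theorem exists_eq_truncation {V : ValuationSubring (RatFunc K)} (hV : V ≤ valRing (ratVal ν hν))
    {f : RatFunc K} (hf : ¬ HasTorsionValue K V.valuation f) :
    ∃ q : K[X], 0 < q.natDegree ∧ ∀ p : K[X], ν p = truncation ν q p := by
  obtain ⟨q, hq⟩ := exists_minimal_not_hasTorsionValue hf
  have hq_pos := natDegree_pos_of_not_hasTorsionValue hq.prop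
  refine ⟨q, hq_pos, fun p => le_antisymm (Finset.le_inf fun i hi => ?_) (truncation_le ν hq_pos p)⟩
  simpa only [ratVal_algebraMap] using le_of_valuation_le hV (map_expansion_term_le hq p hi)

theorem IsValueTranscendental.exists_not_hasTorsionValue (h : IsValueTranscendental ν hν) :
    ∃ f : RatFunc K, ¬ HasTorsionValue K (valRing (ratVal ν hν)).valuation f := by
  obtain ⟨f, γ, hf, hγ⟩ := h
  refine ⟨f, ?_⟩
  rintro ⟨n, hn, a, ha⟩
  refine hγ n hn ((mem_valueGroup_iff _ _).2 ⟨a, ?_⟩)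
  rw [← map_pow] at ha
  rw [← ratVal_algebraMap_base ν hν, ← eq_of_valuation_eq le_rfl ha, AddValuation.map_pow, hf,
    WithTop.coe_nsmul]

theorem IsResidueTranscendental.exists_not_hasTorsionValue (h : IsResidueTranscendental ν hν) :
    ∃ V ≤ valRing (ratVal ν hν), ∃ f : RatFunc K, ¬ HasTorsionValue K V.valuation f := by
  obtain ⟨f, hf⟩ := h
  obtain ⟨V, hV, hfV, hKV⟩ := exists_valuationSubring_le_of_transcendental_residue _ hf
  have h_const : ∀ b : K, 0 ≤ baseVal ν b → V.valuation (algebraMap K (RatFunc K) b) ≤ 1 := by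
    intro b hb
    have hb' : algebraMap K (RatFunc K) b ∈ valRing (ratVal ν hν) := by
      rwa [mem_valRing, ratVal_algebraMap_base]
    exact (V.valuation_le_one_iff _).2 (hKV _ _ (algebraMap_residue ν hν ⟨b, hb⟩ hb').symm)
  have hwf : ratVal ν hν f = 0 := by
    refine (((mem_valRing _ _).1 f.2).eq_of_not_lt fun h_pos => hf ?_).symm
    rw [(residue_eq_zero_iff f).2 (mem_maximalIdeal_valRing_iff.2 h_pos)]
    exact isAlgebraic_zero
  refine ⟨V, hV, f, ?_⟩
  rintro ⟨n, hn, a, ha⟩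
  have hwa : baseVal ν a = 0 := by
    rw [← map_pow] at ha
    rw [← ratVal_algebraMap_base ν hν, ← eq_of_valuation_eq hV ha, AddValuation.map_pow, hwf,
      nsmul_zero]
  have h_lt : V.valuation (algebraMap K (RatFunc K) a) < 1 := ha ▸ pow_lt_one₀ zero_le hfV hn.ne'
  have h_ne : V.valuation (algebraMap K (RatFunc K) a) ≠ 0 := by
    rw [← ha]
    refine pow_ne_zero n ((Valuation.ne_zero_iff _).2 fun h0 => ?_)
    rw [h0, AddValuation.map_zero] at hwf
    exact WithTop.top_ne_zero hwf
  have h_inv := h_const a⁻¹ (by rw [AddValuation.map_inv, hwa]; simp)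
  rw [map_inv₀, map_inv₀] at h_inv
  exact h_inv.not_gt ((one_lt_inv₀ (zero_lt_iff.2 h_ne)).2 h_lt)

theorem IsValuationTranscendental.exists_not_hasTorsionValue (h : IsValuationTranscendental ν hν) :
    ∃ V ≤ valRing (ratVal ν hν), ∃ f : RatFunc K, ¬ HasTorsionValue K V.valuation f :=
  ((isValuationTranscendental_iff ν hν).1 h).elim
    (fun h_value => ⟨_, le_rfl, h_value.exists_not_hasTorsionValue⟩)
    (fun h_residue => h_residue.exists_not_hasTorsionValue)

end Truncation

end ValTrunc

theorem theorem1p3 {K : Type*} [Field K] {Γ : Type*} [AddCommGroup Γ] [LinearOrder Γ]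
    [IsOrderedAddMonoid Γ] (ν : AddValuation (Polynomial K) (WithTop Γ)) (hν : ν.supp = ⊥) :
    ValTrunc.IsValuationTranscendental ν hν ↔
      ∃ q : Polynomial K, 0 < q.natDegree ∧
        ∀ p : Polynomial K, ν p = ValTrunc.truncation ν q p := by
  constructor
  · intro h
    obtain ⟨V, hV, f, hf⟩ := h.exists_not_hasTorsionValue
    exact ValTrunc.exists_eq_truncation hV hf
  · rintro ⟨q, hq, h⟩
    exact ValTrunc.isValuationTranscendental_of_eq_truncation hq h
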